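/- Let $n>0$ and $r>1$ be integers, and let $\Sigma=\{0,\dots,r-1\}^n\cup\{\star\}$. An encoding in base $r$ of a vector $\vec x\in\mathbb R^n$ is an infinite word $u\star v$ over $\Sigma$, where $u$ is a finite word of some length $p\ge 1$ and $v$ an infinite word, both over $\{0,\dots,r-1\}^n$, such that for each component $i$ there is an integer $z$ with $-r^{p-1}\le z<r^{p-1}$ for which the $i$-th component of $u$ is the $r$'s complement representation of $z$ on $p$ digits, most significant digit first (the base-$r$ representation of $z$ if $z\ge 0$, of $z+r^p$ if $z<0$), and $x_i=z+\sum_{k\ge 0}v_{k,i}\,r^{-(k+1)}$, where $v_{k,i}$ is the $i$-th component of the $k$-th letter of $v$. A Real Vector Automaton (RVA) in base $r$ for vectors in $\mathbb R^n$ is a (finite-state) Büchi automaton over $\Sigma$ such that every accepted word is an encoding of some vector in $\mathbb R^n$ and, for each $\vec x\in\mathbb R^n$, either all the encodings of $\vec x$ are accepted or none is; it represents the set of the vectors that are encoded by the words it accepts. A Büchi automaton is inherently weak if no strongly connected component of its transition graph that is reachable from the initial state contains both a cycle going through at least one accepting state and a cycle going through no accepting state. **Theorem.** Every deterministic RVA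 that represents a set definable by a first-order formula (without parameters) in the structure $\langle\mathbb R,\mathbb Z,+,\le\rangle$ is inherently weak. (Here $\mathbb Z$ is the unary predicate "$x$ is an integer" and $+$ is the predicate $x+y=z$.) -/

import Mathlib

open Filter

namespace RVA

/-! ## The first-order theory of `⟨ℝ, ℤ, +, ≤⟩` -/

/-- The relation symbols: `x ∈ ℤ`, the ternary predicate `x + y = z`, and `x ≤ y`. -/
inductive LinRel : ℕ → Type
  | isInt : LinRel 1
  | add : LinRel 3
  | le : LinRel 2

/-- The first-order language of `⟨ℝ, ℤ, +, ≤⟩`; it has no function symbols.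
Quantification over `ℤ` is quantification over `ℝ` relativized to `isInt`. -/
def linLang : FirstOrder.Language where
  Functions := fun _ => Empty
  Relations := LinRel

/-- The structure `⟨ℝ, ℤ, +, ≤⟩`. -/
instance realLinStructure : linLang.Structure ℝ where
  funMap := fun f => nomatch f
  RelMap := fun {_} R => match R with
    | LinRel.isInt => fun x => ∃ z : ℤ, x 0 = (z : ℝ)
    | LinRel.add => fun x => x 0 + x 1 = x 2
    | LinRel.le => fun x => x 0 ≤ x 1

/-- `S ⊆ ℝⁿ` is the set of solutions of a first-order formula of `⟨ℝ, ℤ, +, ≤⟩` with free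
variables among `x₁, …, xₙ` (and without parameters). -/
def DefinableRZ {n : ℕ} (S : Set (Fin n → ℝ)) : Prop :=
  (∅ : Set ℝ).Definable linLang S

/-! ## Büchi automata -/

/-- A (nondeterministic) Büchi automaton over the alphabet `α`, with states `Q`. -/
structure BuchiAutomaton (α : Type*) (Q : Type*) where
  /-- the transition function -/
  step : Q → α → Set Q
  /-- the initial state -/
  start : Q
  /-- the accepting states -/
  accept : Set Q

namespace BuchiAutomaton

variable {α Q : Type*}

/-- The transition function has exactly one value for each state and letter. -/
def IsDeterministic (A : BuchiAutomaton α Q) : Prop :=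
  ∀ q a, ∃ q', A.step q a = {q'}

/-- `π` is a run of `A` on the infinite word `w`. -/
def IsRun (A : BuchiAutomaton α Q) (w : ℕ → α) (π : ℕ → Q) : Prop :=
  π 0 = A.start ∧ ∀ i, π (i + 1) ∈ A.step (π i) (w i)

/-- The set of states that occur infinitely often in `π`. -/
def infOcc (π : ℕ → Q) : Set Q :=
  {q | ∃ᶠ i in atTop, π i = q}

/-- The language of infinite words accepted by `A`. -/
def language (A : BuchiAutomaton α Q) : Set (ℕ → α) :=
  {w | ∃ π, A.IsRun w π ∧ (infOcc π ∩ A.accept).Nonempty}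

/-- The edge relation of the transition graph. -/
def Edge (A : BuchiAutomaton α Q) (q q' : Q) : Prop :=
  ∃ a, q' ∈ A.step q a

/-- There is a (possibly empty) path from `q` to `q'` in the transition graph. -/
def Reaches (A : BuchiAutomaton α Q) : Q → Q → Prop :=
  Relation.ReflTransGen A.Edge

/-- `C` is a strongly connected component of the transition graph, reachable from the
initial state. -/
def IsReachableSCC (A : BuchiAutomaton α Q) (C : Set Q) : Prop :=
  ∃ q, A.Reaches A.start q ∧ C = {q' | A.Reaches q q' ∧ A.Reaches q' q}

/-- `c 0 → c 1 → ⋯ → c m = c 0` is a cycle of length `m > 0` in the transition graph, all of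
whose states belong to `C`. -/
def IsCycleIn (A : BuchiAutomaton α Q) (C : Set Q) (m : ℕ) (c : ℕ → Q) : Prop :=
  0 < m ∧ c m = c 0 ∧ (∀ i < m, A.Edge (c i) (c (i + 1))) ∧ ∀ i < m, c i ∈ C

/-- `C` contains a cycle that goes through at least one accepting state. -/
def HasAcceptingCycle (A : BuchiAutomaton α Q) (C : Set Q) : Prop :=
  ∃ m c, A.IsCycleIn C m c ∧ ∃ i < m, c i ∈ A.accept

/-- `C` contains a cycle that goes through no accepting state. -/
def HasNonacceptingCycle (A : BuchiAutomaton α Q) (C : Set Q) : Prop :=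
  ∃ m c, A.IsCycleIn C m c ∧ ∀ i < m, c i ∉ A.accept

/-- No reachable strongly connected component contains both an accepting and a non-accepting
cycle. -/
def IsInherentlyWeak (A : BuchiAutomaton α Q) : Prop :=
  ∀ C, A.IsReachableSCC C → ¬ (A.HasAcceptingCycle C ∧ A.HasNonacceptingCycle C)

end BuchiAutomaton

/-! ## Encodings of real vectors -/

/-- The alphabet `{0, …, r - 1}ⁿ ∪ {⋆}`; the separator `⋆` is `none`. -/
abbrev Letter (n r : ℕ) : Type := Option (Fin n → Fin r)

/-- The finite word `u` of length `p > 0` (most significant digit first) is the `r`'s complement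
representation of the integer `z`. -/
def EncodesInt {r p : ℕ} (u : Fin p → Fin r) (z : ℤ) : Prop :=
  0 < p ∧ -(r : ℤ) ^ (p - 1) ≤ z ∧ z < (r : ℤ) ^ (p - 1) ∧
    ∑ j : Fin p, ((u j : ℕ) : ℤ) * (r : ℤ) ^ (p - 1 - (j : ℕ)) =
      if 0 ≤ z then z else z + (r : ℤ) ^ p

/-- The infinite word `w` has the form `u ⋆ v` and is an encoding in base `r` of the vector `x`:
in each component `i`, the number `x i` is the sum of an integer encoded by `u` and of the number
`0.v₀v₁v₂…` of `[0, 1]`.  -/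
def IsEncoding {n r : ℕ} (w : ℕ → Letter n r) (x : Fin n → ℝ) : Prop :=
  ∃ (p : ℕ) (u : Fin p → Fin n → Fin r) (v : ℕ → Fin n → Fin r),
    (∀ j : Fin p, w j = some (u j)) ∧ w p = none ∧ (∀ k, w (p + 1 + k) = some (v k)) ∧
    ∀ i, ∃ z : ℤ, EncodesInt (fun j => u j i) z ∧
      x i = (z : ℝ) + Real.ofDigits (fun k => v k i)

/-! ## Real Vector Automata -/

/-- `A` is a Real Vector Automaton in base `r` for vectors in `ℝⁿ`. -/
def IsRVA {n r : ℕ} {Q : Type*} (A : BuchiAutomaton (Letter n r) Q) : Prop :=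
  (∀ w ∈ A.language, ∃ x : Fin n → ℝ, IsEncoding w x) ∧
  ∀ x : Fin n → ℝ,
    (∀ w, IsEncoding w x → w ∈ A.language) ∨ (∀ w, IsEncoding w x → w ∉ A.language)

/-- The set of vectors represented by `A`: those encoded by the words that `A` accepts. -/
def representedSet {n r : ℕ} {Q : Type*} (A : BuchiAutomaton (Letter n r) Q) :
    Set (Fin n → ℝ) :=
  {x | ∃ w ∈ A.language, IsEncoding w x}

end RVA

/-!
The proof compares Borel classes. On one side, every set definable in `⟨ℝ, ℤ, +, ≤⟩` is `Fσ`
(`RVA.DefinableRZ.isGδ_compl`). On the other side, a failure of inherent weakness makes the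
represented set pull back, along a continuous map from the Cantor space `ℕ → Bool`, to the set of
the sequences with infinitely many `true`, which is not `Fσ` by the Baire category theorem
(`RVA.not_isGδ_eventually_false`).

For definable sets, call a set cellular if there are finitely many affine forms such that membership
of `x` depends only on the integer parts of the coordinates of `x` and on the signs of these forms
at the vector of fractional parts. The atomic formulas define cellular sets, cellular sets form a
Boolean algebra, and they are closed under projection (`RVA.IsCellular.exists_snoc`): the integer
part of the quantified variable is kept and its fractional part is eliminated as in the
Fourier–Motzkin method (`RVA.exists_finite_elimination`). The forms do not depend on the integer
parts, so the infinitely many possible integer parts of the quantified variable do no harm. A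
cellular set is a union of countably many cells, and the complement of each cell is `Gδ`.

For the automaton, suppose that a reachable strongly connected component contains both kinds of
cycles. Then there are a word `s` leading to some state `q` of the component and two words of the
same length that loop at `q`, one of which visits an accepting state while the other one does not
(`RVA.BuchiAutomaton.exists_walks_of_not_isInherentlyWeak`). By determinism, `s` followed by a
sequence of these blocks is accepted if and only if the first block occurs infinitely often. All
these words turn out to be encodings, because the separator has to be in `s`, and the encoded vector
depends continuously on the sequence of blocks (`RVA.exists_continuous_isEncoding`). By the
invariance of an RVA under the choice of the encoding, that vector is represented if and only if the
first block occurs infinitely often.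
-/

namespace RVA

open SignType (sign)

/-! ### Affine forms and elimination of a variable -/

/-- Affine forms `x ↦ ∑ i, a i * x i + b` on `ℝ^ι`, stored as the pair `(a, b)`. -/
abbrev AffForm (ι : Type*) : Type _ := (ι → ℝ) × ℝ

namespace AffForm

variable {ι : Type*} [Fintype ι]

/-- The value of an affine form at a point. -/
def eval (f : AffForm ι) (x : ι → ℝ) : ℝ := f.1 ⬝ᵥ x + f.2

lemma eval_sub (f g : AffForm ι) (x : ι → ℝ) : eval (f - g) x = eval f x - eval g x := by
  simp [eval, sub_dotProduct]; ring

lemma eval_smul (c : ℝ) (f : AffForm ι) (x : ι → ℝ) : eval (c • f) x = c * eval f x := by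
  simp [eval, smul_dotProduct]; ring

lemma continuous_eval (f : AffForm ι) : Continuous (eval f) := by
  unfold eval dotProduct; fun_prop

/-- The affine form in the variables other than the last one that is obtained from `f` by
setting the last variable to `0`. -/
def dropLast {α : Type*} {k : ℕ} (f : AffForm (α ⊕ Fin (k + 1))) : AffForm (α ⊕ Fin k) :=
  (Sum.elim (fun i => f.1 (Sum.inl i)) (fun j => f.1 (Sum.inr j.castSucc)), f.2)

lemma eval_snoc {α : Type*} [Fintype α] {k : ℕ} (f : AffForm (α ⊕ Fin (k + 1)))
    (v : α → ℝ) (xs : Fin k → ℝ) (t : ℝ) :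
    eval f (Sum.elim v (Fin.snoc xs t : Fin (k + 1) → ℝ)) =
      eval f.dropLast (Sum.elim v xs) + f.1 (Sum.inr (Fin.last k)) * t := by
  simp [eval, dropLast, dotProduct, Fin.sum_univ_castSucc]; ring

end AffForm

section Elimination

variable {ι : Type*} [Fintype ι]

/-- Fourier–Motzkin elimination of one variable `t`. If the roots in `t` of the forms
`g + a * t` are in the same order at `x` and at `y`, then every position of `t` relative to the
roots at `x` is also a position relative to the roots at `y`. -/
lemma exists_finite_elimination {F : Set (AffForm ι × ℝ)} (hF : F.Finite) :
    ∃ G : Set (AffForm ι), G.Finite ∧ ∀ x y : ι → ℝ,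
      (∀ g ∈ G, sign (g.eval x) = sign (g.eval y)) →
      ∀ t : ℝ, ∃ t' : ℝ, ∀ f ∈ F,
        sign (f.1.eval x + f.2 * t) = sign (f.1.eval y + f.2 * t') := by
  classical
  set root : AffForm ι × ℝ → AffForm ι := fun f => (-f.2⁻¹) • f.1 with hroot
  refine ⟨Prod.fst '' F ∪ Set.image2 (fun f f' => root f - root f') F F,
    (hF.image _).union (hF.image2 _ hF), fun x y hxy t => ?_⟩
  have hG : ∀ f ∈ F, sign (f.1.eval x) = sign (f.1.eval y) := fun f hf =>
    hxy _ (Or.inl ⟨f, hf, rfl⟩)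
  have hR : ∀ f ∈ F, ∀ f' ∈ F, sign ((root f).eval x - (root f').eval x) =
      sign ((root f).eval y - (root f').eval y) := fun f hf f' hf' => by
    simpa only [AffForm.eval_sub] using hxy _ (Or.inr ⟨f, hf, f', hf', rfl⟩)
  -- it suffices to place `t'` relative to the roots
  suffices h : ∃ t', ∀ f ∈ F, sign (t - (root f).eval x) = sign (t' - (root f).eval y) by
    obtain ⟨t', ht'⟩ := h
    refine ⟨t', fun f hf => ?_⟩
    rcases eq_or_ne f.2 0 with ha | ha
    · simpa [ha] using hG f hf
    · have key : ∀ (z : ι → ℝ) (s : ℝ), f.1.eval z + f.2 * s = f.2 * (s - (root f).eval z) := by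
        intro z s
        simp only [hroot, AffForm.eval_smul]
        field_simp
        ring
      rw [key, key, sign_mul, sign_mul, ht' f hf]
  by_cases h : ∃ f ∈ F, t = (root f).eval x
  · obtain ⟨f, hf, rfl⟩ := h
    exact ⟨(root f).eval y, fun f' hf' => hR f hf f' hf'⟩
  · push Not at h
    obtain ⟨t', hlo, hhi⟩ := Order.exists_between_finsets
      ((hF.toFinset.filter fun f => (root f).eval x < t).image fun f => (root f).eval y)
      ((hF.toFinset.filter fun f => t < (root f).eval x).image fun f => (root f).eval y) (by
        simp only [Finset.mem_image, Finset.mem_filter, Set.Finite.mem_toFinset]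
        rintro _ ⟨f, ⟨hf, h1⟩, rfl⟩ _ ⟨f', ⟨hf', h2⟩, rfl⟩
        have h3 := hR f hf f' hf'
        rw [sign_neg (by linarith), eq_comm, sign_eq_neg_one_iff] at h3
        linarith)
    simp only [Finset.mem_image, Finset.mem_filter, Set.Finite.mem_toFinset, forall_exists_index,
      and_imp] at hlo hhi
    refine ⟨t', fun f hf => ?_⟩
    rcases lt_or_gt_of_ne (h f hf) with h1 | h1
    · rw [sign_neg (by linarith), sign_neg (by linarith [hhi _ f hf h1 rfl])]
    · rw [sign_pos (by linarith), sign_pos (by linarith [hlo _ f hf h1 rfl])]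

/-! ### Cellular sets -/

/-- `x` and `y` lie in the same cell of the partition of `ℝ^ι` given by the integer parts of the
coordinates and by the signs that the forms in `F` take at the vector of fractional parts. -/
def SameCell (F : Set (AffForm ι)) (x y : ι → ℝ) : Prop :=
  (∀ i, ⌊x i⌋ = ⌊y i⌋) ∧
    ∀ f ∈ F, sign (f.eval fun i => Int.fract (x i)) = sign (f.eval fun i => Int.fract (y i))

lemma SameCell.symm {F : Set (AffForm ι)} {x y : ι → ℝ} (h : SameCell F x y) : SameCell F y x :=
  ⟨fun i => (h.1 i).symm, fun f hf => (h.2 f hf).symm⟩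

lemma SameCell.mono {F G : Set (AffForm ι)} (hFG : F ⊆ G) {x y : ι → ℝ} (h : SameCell G x y) :
    SameCell F x y :=
  ⟨h.1, fun f hf => h.2 f (hFG hf)⟩

/-- `S` is a union of cells for a finite set of affine forms. The same forms serve in all the unit
cubes with integer corners; this uniformity is what makes the class closed under projection. -/
def IsCellular (S : Set (ι → ℝ)) : Prop :=
  ∃ F : Set (AffForm ι), F.Finite ∧ ∀ x y, SameCell F x y → x ∈ S → y ∈ S

lemma IsCellular.compl {S : Set (ι → ℝ)} (h : IsCellular S) : IsCellular Sᶜ := by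
  obtain ⟨F, hF, h⟩ := h
  exact ⟨F, hF, fun x y hxy hx hy => hx (h y x hxy.symm hy)⟩

lemma IsCellular.union {S T : Set (ι → ℝ)} (hS : IsCellular S) (hT : IsCellular T) :
    IsCellular (S ∪ T) := by
  obtain ⟨F, hF, hS⟩ := hS
  obtain ⟨G, hG, hT⟩ := hT
  exact ⟨F ∪ G, hF.union hG, fun x y hxy => Or.imp (hS x y (hxy.mono Set.subset_union_left))
    (hT x y (hxy.mono Set.subset_union_right))⟩

lemma isCellular_isInt (i : ι) : IsCellular {x : ι → ℝ | ∃ z : ℤ, x i = z} := by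
  classical
  refine ⟨{(Pi.single i 1, 0)}, Set.finite_singleton _, ?_⟩
  rintro x y ⟨-, h⟩ ⟨z, hz⟩
  have h := h _ rfl
  simp only [AffForm.eval, single_dotProduct, one_mul, add_zero, hz, Int.fract_intCast,
    sign_zero] at h
  rw [eq_comm, sign_eq_zero_iff] at h
  exact ⟨⌊y i⌋, by linarith [Int.floor_add_fract (y i)]⟩

lemma isCellular_le (i j : ι) : IsCellular {x : ι → ℝ | x i ≤ x j} := by
  classical
  refine ⟨{(Pi.single i 1 - Pi.single j 1, 0)}, Set.finite_singleton _, ?_⟩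
  rintro x y ⟨hfl, h⟩ hx
  have h := h _ rfl
  simp only [AffForm.eval, sub_dotProduct, single_dotProduct, one_mul, add_zero] at h
  simp only [Set.mem_ofPred_eq] at hx ⊢
  have hx' := Int.floor_le_floor hx
  rw [hfl i, hfl j] at hx'
  have ei := Int.floor_add_fract (y i)
  have ej := Int.floor_add_fract (y j)
  rcases hx'.lt_or_eq with hlt | heq
  · have h1 : (⌊y i⌋ : ℝ) + 1 ≤ ⌊y j⌋ := by exact_mod_cast hlt
    linarith [Int.fract_lt_one (y i), Int.fract_nonneg (y j)]
  · have ei' := Int.floor_add_fract (x i)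
    have ej' := Int.floor_add_fract (x j)
    rw [hfl i, heq] at ei'
    rw [hfl j] at ej'
    rw [heq] at ei
    have h1 : sign (Int.fract (x i) - Int.fract (x j)) ≤ 0 := sign_nonpos_iff.2 (by linarith)
    rw [h, sign_nonpos_iff] at h1
    linarith

lemma isCellular_eq (i j : ι) : IsCellular {x : ι → ℝ | x i = x j} := by
  have h := ((isCellular_le i j).compl.union (isCellular_le j i).compl).compl
  convert h using 1
  ext x
  simp [le_antisymm_iff]

lemma isCellular_add (i j k : ι) : IsCellular {x : ι → ℝ | x i + x j = x k} := by
  classical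
  -- the carry `⌊x k⌋ - ⌊x i⌋ - ⌊x j⌋` of the addition is `0` or `1`
  refine ⟨{(Pi.single i 1 + Pi.single j 1 - Pi.single k 1, 0),
    (Pi.single i 1 + Pi.single j 1 - Pi.single k 1, -1)}, by simp, ?_⟩
  rintro x y ⟨hfl, h⟩ hx
  have h0 := h _ (Or.inl rfl)
  have h1 := h _ (Or.inr rfl)
  simp only [AffForm.eval, sub_dotProduct, add_dotProduct, single_dotProduct, one_mul,
    add_zero] at h0 h1
  simp only [Set.mem_ofPred_eq] at hx ⊢
  have ei := Int.floor_add_fract (x i)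
  have ej := Int.floor_add_fract (x j)
  have ek := Int.floor_add_fract (x k)
  rw [hfl] at ei ej ek
  have ei' := Int.floor_add_fract (y i)
  have ej' := Int.floor_add_fract (y j)
  have ek' := Int.floor_add_fract (y k)
  have hc : Int.fract (x i) + Int.fract (x j) - Int.fract (x k) =
      ((⌊y k⌋ - ⌊y i⌋ - ⌊y j⌋ : ℤ) : ℝ) := by push_cast; linarith
  have hlo : (-1 : ℝ) < ((⌊y k⌋ - ⌊y i⌋ - ⌊y j⌋ : ℤ) : ℝ) := by
    rw [← hc]
    linarith [Int.fract_lt_one (x k), Int.fract_nonneg (x i), Int.fract_nonneg (x j)]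
  have hhi : ((⌊y k⌋ - ⌊y i⌋ - ⌊y j⌋ : ℤ) : ℝ) < 2 := by
    rw [← hc]
    linarith [Int.fract_nonneg (x k), Int.fract_lt_one (x i), Int.fract_lt_one (x j)]
  have hlo' : -1 < ⌊y k⌋ - ⌊y i⌋ - ⌊y j⌋ := by exact_mod_cast hlo
  have hhi' : ⌊y k⌋ - ⌊y i⌋ - ⌊y j⌋ < 2 := by exact_mod_cast hhi
  obtain hcz | hcz : ⌊y k⌋ - ⌊y i⌋ - ⌊y j⌋ = 0 ∨ ⌊y k⌋ - ⌊y i⌋ - ⌊y j⌋ = 1 := by omega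
  · have hcr : (⌊y k⌋ : ℝ) - ⌊y i⌋ - ⌊y j⌋ = 0 := by exact_mod_cast hcz
    rw [hc, hcz, Int.cast_zero, sign_zero, eq_comm, sign_eq_zero_iff] at h0
    linarith
  · have hcr : (⌊y k⌋ : ℝ) - ⌊y i⌋ - ⌊y j⌋ = 1 := by exact_mod_cast hcz
    rw [hc, hcz, Int.cast_one, add_neg_cancel, sign_zero, eq_comm, sign_eq_zero_iff] at h1
    linarith

end Elimination

/-- Projecting out the last coordinate. The fractional part of that coordinate is moved by
Fourier–Motzkin elimination and its integer part is kept. -/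
lemma IsCellular.exists_snoc {α : Type*} [Fintype α] {k : ℕ} {S : Set (α ⊕ Fin (k + 1) → ℝ)}
    (hS : IsCellular S) :
    IsCellular {x : α ⊕ Fin k → ℝ | ∃ t : ℝ,
      Sum.elim (x ∘ Sum.inl) (Fin.snoc (x ∘ Sum.inr) t : Fin (k + 1) → ℝ) ∈ S} := by
  obtain ⟨F, hF, hS⟩ := hS
  -- the forms `t` and `t - 1` ensure that the new fractional part lies in `[0, 1)`
  obtain ⟨G, hG, h⟩ := exists_finite_elimination
    (F := (fun f => (f.dropLast, f.1 (Sum.inr (Fin.last k)))) '' F ∪ {(0, 1), ((0, -1), 1)})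
    ((hF.image _).union (by simp))
  refine ⟨G, hG, ?_⟩
  rintro x y ⟨hfl, hxy⟩ ⟨t, ht⟩
  obtain ⟨s, hs⟩ := h _ _ hxy (Int.fract t)
  have hs0 := hs (0, 1) (by simp)
  have hs1 := hs ((0, -1), 1) (by simp)
  simp only [AffForm.eval, zero_dotProduct, Prod.fst_zero, Prod.snd_zero, zero_add, one_mul,
    add_zero] at hs0 hs1
  have h0 : 0 ≤ s := by rw [← sign_nonneg_iff, ← hs0, sign_nonneg_iff]; exact Int.fract_nonneg t
  have h1 : s < 1 := by
    rw [sign_neg (by linarith [Int.fract_lt_one t]), eq_comm, sign_eq_neg_one_iff] at hs1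
    linarith
  have hfr : Int.fract ((⌊t⌋ : ℝ) + s) = s := by
    rw [Int.fract_intCast_add, Int.fract_eq_self.2 ⟨h0, h1⟩]
  have hfl' : ⌊(⌊t⌋ : ℝ) + s⌋ = ⌊t⌋ := by
    rw [Int.floor_intCast_add, Int.floor_eq_zero_iff.2 ⟨h0, h1⟩, add_zero]
  have hcomp : ∀ (z : α ⊕ Fin k → ℝ) (u : ℝ),
      (fun i => Int.fract (Sum.elim (z ∘ Sum.inl)
        (Fin.snoc (z ∘ Sum.inr) u : Fin (k + 1) → ℝ) i)) =
      Sum.elim ((fun i => Int.fract (z i)) ∘ Sum.inl)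
        (Fin.snoc ((fun i => Int.fract (z i)) ∘ Sum.inr) (Int.fract u) : Fin (k + 1) → ℝ) := by
    intro z u
    ext (i | i)
    · rfl
    · refine Fin.lastCases ?_ (fun j => ?_) i <;> simp
  refine ⟨⌊t⌋ + s, hS _ _ ⟨?_, fun f hf => ?_⟩ ht⟩
  · rintro (i | i)
    · exact hfl _
    · refine Fin.lastCases ?_ (fun j => ?_) i
      · simpa [eq_comm] using hfl'
      · simpa using hfl (Sum.inr j)
  · rw [hcomp, hcomp, AffForm.eval_snoc, AffForm.eval_snoc, hfr, Sum.elim_comp_inl_inr,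
      Sum.elim_comp_inl_inr]
    exact hs _ (Or.inl ⟨f, hf, rfl⟩)

/-! ### Definable sets are cellular, and cellular sets are `Gδ` -/

/-- The language has no function symbols, so every term is a variable. -/
lemma exists_var_eq {β : Type*} (t : linLang.Term β) : ∃ i, t = FirstOrder.Language.var i := by
  cases t with
  | var i => exact ⟨i, rfl⟩
  | func f _ => exact f.elim

/-- Induction on the formula; the quantifier case is closure under projection. -/
lemma isCellular_realize {α : Type} [Fintype α] {k : ℕ} (φ : linLang.BoundedFormula α k) :
    IsCellular {x : α ⊕ Fin k → ℝ | φ.Realize (x ∘ Sum.inl) (x ∘ Sum.inr)} := by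
  induction φ with
  | falsum => exact ⟨∅, Set.finite_empty, fun x y _ h => h⟩
  | equal t₁ t₂ =>
    obtain ⟨i, rfl⟩ := exists_var_eq t₁
    obtain ⟨j, rfl⟩ := exists_var_eq t₂
    simpa [FirstOrder.Language.BoundedFormula.Realize, Sum.elim_comp_inl_inr] using
      isCellular_eq i j
  | rel R ts =>
    choose i hi using fun j => exists_var_eq (ts j)
    obtain rfl : ts = fun j => FirstOrder.Language.var (i j) := funext hi
    cases R with
    | isInt =>
      convert isCellular_isInt (i 0) using 1
      ext x
      simp only [FirstOrder.Language.BoundedFormula.Realize, Sum.elim_comp_inl_inr]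
      rfl
    | add =>
      convert isCellular_add (i 0) (i 1) (i 2) using 1
      ext x
      simp only [FirstOrder.Language.BoundedFormula.Realize, Sum.elim_comp_inl_inr]
      rfl
    | le =>
      convert isCellular_le (i 0) (i 1) using 1
      ext x
      simp only [FirstOrder.Language.BoundedFormula.Realize, Sum.elim_comp_inl_inr]
      rfl
  | imp φ ψ hφ hψ =>
    convert hφ.compl.union hψ using 1
    ext x
    simp [imp_iff_not_or]
  | all φ hφ =>
    convert hφ.compl.exists_snoc.compl using 1
    ext x
    simp [FirstOrder.Language.BoundedFormula.realize_all, Function.comp_def]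

lemma isGδ_sign_ne (s : SignType) : IsGδ {a : ℝ | sign a ≠ s} := by
  have h0 : {a : ℝ | sign a ≠ 0} = {0}ᶜ := by ext a; simp
  have h1 : {a : ℝ | sign a ≠ 1} = Set.Iic 0 := by
    ext a; simp [sign_eq_one_iff]
  have h2 : {a : ℝ | sign a ≠ -1} = Set.Ici 0 := by
    ext a; simp [sign_eq_neg_one_iff]
  cases s
  · exact h0 ▸ isOpen_compl_singleton.isGδ
  · exact h2 ▸ isClosed_Ici.isGδ
  · exact h1 ▸ isClosed_Iic.isGδ

/-- The complement of a cell is a `Gδ` set, as a finite union of open and of closed sets. -/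
lemma isGδ_compl_cell {ι : Type*} [Fintype ι] {F : Set (AffForm ι)} (hF : F.Finite)
    (z : ι → ℤ) (σ : F → SignType) :
    IsGδ {x : ι → ℝ | (∀ i, ⌊x i⌋ = z i) ∧
      ∀ f : F, sign (f.1.eval fun i => Int.fract (x i)) = σ f}ᶜ := by
  have := hF.to_subtype
  have heq : {x : ι → ℝ | (∀ i, ⌊x i⌋ = z i) ∧
      ∀ f : F, sign (f.1.eval fun i => Int.fract (x i)) = σ f}ᶜ =
      ((⋃ i, {x : ι → ℝ | x i < z i}) ∪ ⋃ i, {x : ι → ℝ | (z i : ℝ) + 1 ≤ x i}) ∪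
        ⋃ f : F, (fun x : ι → ℝ => f.1.eval fun i => x i - z i) ⁻¹' {a | sign a ≠ σ f} := by
    ext x
    by_cases hx : ∀ i, ⌊x i⌋ = z i
    · have hx' : ∀ i, ¬ x i < z i ∧ ¬ (z i : ℝ) + 1 ≤ x i := fun i => by
        have := Int.floor_eq_iff.1 (hx i)
        exact ⟨not_lt.2 this.1, not_le.2 this.2⟩
      have hfr : ∀ i, Int.fract (x i) = x i - z i := fun i => by rw [← hx i]; rfl
      have h1 : ∀ i, ¬ x i < z i := fun i => (hx' i).1
      have h2 : ∀ i, ¬ (z i : ℝ) + 1 ≤ x i := fun i => (hx' i).2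
      simp only [Set.mem_compl_iff, Set.mem_ofPred_eq, Set.mem_union, Set.mem_iUnion,
        Set.mem_preimage, hx, h1, h2, hfr, implies_true, true_and, exists_false, false_or,
        not_forall, ne_eq]
    · refine iff_of_true (fun h => hx h.1) (Or.inl ?_)
      push Not at hx
      obtain ⟨i, hi⟩ := hx
      rw [Ne, Int.floor_eq_iff, not_and_or, not_le, not_lt] at hi
      exact hi.imp (fun h => Set.mem_iUnion.2 ⟨i, h⟩) (fun h => Set.mem_iUnion.2 ⟨i, h⟩)
  rw [heq]
  refine (IsGδ.union ?_ ?_).union ?_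
  · exact (isOpen_iUnion fun i => isOpen_lt (continuous_apply i) continuous_const).isGδ
  · exact IsGδ.iUnion fun i =>
      (isClosed_le continuous_const (continuous_apply i)).isGδ
  · exact IsGδ.iUnion fun f => (isGδ_sign_ne _).preimage
      (f.1.continuous_eval.comp (by fun_prop))

/-- A cellular set is the complement of a union of cells, and there are only countably many
cells. -/
lemma IsCellular.isGδ {ι : Type*} [Fintype ι] {S : Set (ι → ℝ)} (hS : IsCellular S) :
    IsGδ S := by
  obtain ⟨F, hF, hS⟩ := hS
  have := hF.to_subtype
  let cell : (ι → ℤ) × (F → SignType) → Set (ι → ℝ) := fun p =>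
    {x | (∀ i, ⌊x i⌋ = p.1 i) ∧ ∀ f : F, sign (f.1.eval fun i => Int.fract (x i)) = p.2 f}
  have heq : S = ⋂ p ∈ {p | Disjoint (cell p) S}, (cell p)ᶜ := by
    ext y
    simp only [Set.mem_iInter, Set.mem_ofPred_eq, Set.mem_compl_iff]
    refine ⟨fun hy p hp hyp => Set.disjoint_left.1 hp hyp hy, fun h => ?_⟩
    by_contra hy
    refine h (fun i => ⌊y i⌋, fun f => sign (f.1.eval fun i => Int.fract (y i))) ?_
      ⟨fun _ => rfl, fun _ => rfl⟩
    rw [Set.disjoint_left]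
    exact fun x hx hxS => hy (hS x y ⟨hx.1, fun f hf => hx.2 ⟨f, hf⟩⟩ hxS)
  rw [heq]
  exact IsGδ.biInter (Set.to_countable _) fun p _ => isGδ_compl_cell hF p.1 p.2

/-- Definable sets are `Fσ`. -/
lemma DefinableRZ.isGδ_compl {n : ℕ} {S : Set (Fin n → ℝ)} (hS : DefinableRZ S) : IsGδ Sᶜ := by
  obtain ⟨φ, rfl⟩ := Set.empty_definable_iff.1 hS
  have h := (isCellular_realize φ).compl.isGδ
  have hc : Continuous fun x : Fin n → ℝ => Sum.elim x (default : Fin 0 → ℝ) := by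
    refine continuous_pi ?_
    rintro (i | i)
    · exact continuous_apply i
    · exact i.elim0
  convert h.preimage hc using 1
  ext x
  simp [FirstOrder.Language.Formula.Realize, Unique.eq_default]

/-! ### Sequences with infinitely many marks, and the Baire category theorem -/

/-- This set and its complement are both dense in the Cantor space, and the complement is `Gδ`. If
this set were `Gδ` as well, the two would meet by the Baire category theorem. -/
lemma not_isGδ_eventually_false : ¬ IsGδ {b : ℕ → Bool | ¬ ∃ᶠ i in atTop, b i = true} := by
  intro h
  have hG : IsGδ {b : ℕ → Bool | ∃ᶠ i in atTop, b i = true} := by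
    have heq : {b : ℕ → Bool | ∃ᶠ i in atTop, b i = true} =
        ⋂ N : ℕ, ⋃ i ≥ N, (fun b : ℕ → Bool => b i) ⁻¹' {true} := by
      ext b
      simp [frequently_atTop]
    rw [heq]
    exact IsGδ.iInter_of_isOpen fun N => isOpen_biUnion fun i _ =>
      (isOpen_discrete {true}).preimage (continuous_apply i)
  -- changing a sequence from index `N` on to a constant approximates it as `N` grows
  have happrox : ∀ (b : ℕ → Bool) (c : Bool),
      Tendsto (fun N i => if i < N then b i else c) atTop (nhds b) := fun b c =>
    tendsto_pi_nhds.2 fun i => tendsto_const_nhds.congr' <| by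
      filter_upwards [eventually_gt_atTop i] with N hN
      simp [hN]
  have hd1 : Dense {b : ℕ → Bool | ∃ᶠ i in atTop, b i = true} := fun b =>
    mem_closure_of_tendsto (happrox b true) <| Eventually.of_forall fun N =>
      Eventually.frequently <| by
        filter_upwards [eventually_ge_atTop N] with i hi
        simp [not_lt.2 hi]
  have hd2 : Dense {b : ℕ → Bool | ¬ ∃ᶠ i in atTop, b i = true} := fun b =>
    mem_closure_of_tendsto (happrox b false) <| Eventually.of_forall fun N => by
      simp only [Set.mem_ofPred_eq, not_frequently]
      filter_upwards [eventually_ge_atTop N] with i hi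
      simp [not_lt.2 hi]
  obtain ⟨b, hb, hb'⟩ := (hd1.inter_of_Gδ hG h hd2).nonempty
  exact hb' hb

/-! ### Walks in an automaton -/

/-- The sequence that follows `f` before position `N` and then `g` from its beginning. -/
def glue {β : Type*} (N : ℕ) (f g : ℕ → β) (i : ℕ) : β :=
  if i < N then f i else g (i - N)

lemma glue_of_lt {β : Type*} {N i : ℕ} (f g : ℕ → β) (h : i < N) : glue N f g i = f i :=
  if_pos h

lemma glue_add {β : Type*} (N : ℕ) (f g : ℕ → β) (i : ℕ) : glue N f g (N + i) = g i := by
  simp [glue]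

/-- The concatenation of the blocks `f (b 0)`, `f (b 1)`, …, each cut to length `m`. -/
def blocks {ι β : Type*} (m : ℕ) (f : ι → ℕ → β) (b : ℕ → ι) (k : ℕ) : β :=
  f (b (k / m)) (k % m)

lemma blocks_mul_add {ι β : Type*} {m : ℕ} (f : ι → ℕ → β) (b : ℕ → ι) (j : ℕ) {i : ℕ}
    (hi : i < m) : blocks m f b (m * j + i) = f (b j) i := by
  have hm : 0 < m := by omega
  rw [blocks, Nat.mul_add_mod, Nat.mod_eq_of_lt hi, Nat.mul_add_div hm, Nat.div_eq_of_lt hi,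
    add_zero]

namespace BuchiAutomaton

variable {α Q : Type*} {A : BuchiAutomaton α Q}

/-- The first `m` steps of `π` follow the transitions of `A` on the letters of `w`. -/
def IsWalk (A : BuchiAutomaton α Q) (m : ℕ) (w : ℕ → α) (π : ℕ → Q) : Prop :=
  ∀ i < m, π (i + 1) ∈ A.step (π i) (w i)

lemma IsWalk.glue {N m : ℕ} {w w' : ℕ → α} {π π' : ℕ → Q} (h : A.IsWalk N w π)
    (h' : A.IsWalk m w' π') (hπ : π N = π' 0) :
    A.IsWalk (N + m) (glue N w w') (glue N π π') := by
  intro i hi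
  rcases lt_or_ge i N with hiN | hiN
  · rw [glue_of_lt _ _ hiN, glue_of_lt _ _ hiN]
    rcases (Nat.succ_le_of_lt hiN).lt_or_eq with h1 | h1
    · rw [glue_of_lt _ _ h1]
      exact h i hiN
    · have h2 := h i hiN
      rw [← Nat.succ_eq_add_one, h1] at h2 ⊢
      have h3 := glue_add N π π' 0
      rw [add_zero] at h3
      rwa [h3, ← hπ]
  · obtain ⟨k, rfl⟩ := Nat.exists_eq_add_of_le hiN
    rw [add_assoc, glue_add, glue_add, glue_add]
    exact h' k (by omega)

lemma IsWalk.blocks {ι : Type*} {m : ℕ} (hm : 0 < m) {w : ι → ℕ → α} {π : ι → ℕ → Q} {q : Q}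
    (h : ∀ j, A.IsWalk m (w j) (π j)) (h0 : ∀ j, π j 0 = q) (hq : ∀ j, π j m = q)
    (b : ℕ → ι) (N : ℕ) : A.IsWalk N (blocks m w b) (blocks m π b) := by
  intro k _
  obtain ⟨j, i, hi, rfl⟩ : ∃ j i, i < m ∧ k = m * j + i :=
    ⟨k / m, k % m, Nat.mod_lt _ hm, (Nat.div_add_mod k m).symm⟩
  rw [blocks_mul_add _ _ _ hi, blocks_mul_add _ _ _ hi]
  rcases (Nat.succ_le_of_lt hi).lt_or_eq with h1 | h1
  · rw [add_assoc, blocks_mul_add _ _ _ h1]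
    exact h _ i hi
  · have h2 := h (b j) i hi
    rw [show m * j + i + 1 = m * (j + 1) + 0 by rw [mul_add]; omega, blocks_mul_add _ _ _ hm, h0]
    rwa [show i + 1 = m from h1, hq] at h2

lemma Reaches.exists_isWalk [Nonempty α] {q q' : Q} (h : A.Reaches q q') :
    ∃ m w π, A.IsWalk m w π ∧ π 0 = q ∧ π m = q' := by
  induction h with
  | refl =>
    exact ⟨0, fun _ => Classical.arbitrary α, fun _ => q, fun i hi => absurd hi (by omega),
      rfl, rfl⟩
  | @tail b c _ hbc ih =>
    obtain ⟨m, w, π, hw, h0, hm⟩ := ih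
    obtain ⟨a, ha⟩ := hbc
    have h1 : A.IsWalk 1 (fun _ => a) (fun i => if i = 0 then b else c) := by
      intro i hi
      obtain rfl : i = 0 := by omega
      simpa using ha
    refine ⟨m + 1, _, _, hw.glue h1 (by simpa using hm), ?_, by simp [glue_add]⟩
    rcases Nat.eq_zero_or_pos m with rfl | hm0
    · simpa [RVA.glue, h0] using hm.symm
    · rw [glue_of_lt _ _ hm0, h0]

/-- A closed walk can be traversed any number of times. -/
lemma IsWalk.repeat {m : ℕ} (hm : 0 < m) {w : ℕ → α} {π : ℕ → Q} (h : A.IsWalk m w π)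
    (hπ : π m = π 0) (j : ℕ) :
    A.IsWalk (m * j) (fun k => w (k % m)) (fun k => π (k % m)) :=
  IsWalk.blocks hm (ι := Unit) (w := fun _ => w) (π := fun _ => π) (fun _ => h) (fun _ => rfl)
    (fun _ => hπ) (fun _ => ()) _

/-- An accepting and a nonaccepting cycle in a reachable strongly connected component give two
closed walks of the same length at a state reachable from the initial one: `true` visits an
accepting state and `false` does not. -/
lemma exists_walks_of_not_isInherentlyWeak [Nonempty α] (h : ¬ A.IsInherentlyWeak) :
    ∃ (l m : ℕ) (s : ℕ → α) (σ : ℕ → Q) (w : Bool → ℕ → α) (π : Bool → ℕ → Q),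
      A.IsWalk l s σ ∧ σ 0 = A.start ∧ 0 < m ∧ (∀ j, A.IsWalk m (w j) (π j)) ∧
      (∀ j, π j 0 = σ l) ∧ (∀ j, π j m = σ l) ∧
      (∃ i < m, π true i ∈ A.accept) ∧ ∀ i < m, π false i ∉ A.accept := by
  simp only [IsInherentlyWeak, not_forall, not_not] at h
  obtain ⟨C, ⟨q₀, hq₀, rfl⟩, ⟨m₁, c₁, ⟨hm₁, -, -, hC₁⟩, i₁, hi₁, hacc⟩,
    m₂, c₂, ⟨hm₂, hc₂, hE₂, hC₂⟩, hrej⟩ := h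
  obtain ⟨l, s, σ, hs, hσ, hl⟩ := Reaches.exists_isWalk (hq₀.trans (hC₂ 0 hm₂).1)
  -- the accepting closed walk goes from `c₂ 0` to the accepting state `c₁ i₁` and back
  obtain ⟨k, u, τ, hu, hτ, hk⟩ :=
    Reaches.exists_isWalk ((hC₂ 0 hm₂).2.trans (hC₁ i₁ hi₁).1)
  obtain ⟨k', u', τ', hu', hτ', hk'⟩ :=
    Reaches.exists_isWalk ((hC₁ i₁ hi₁).2.trans (hC₂ 0 hm₂).1)
  -- it has positive length since `c₂ 0` is not accepting
  have hkpos : 0 < k := by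
    refine Nat.pos_of_ne_zero fun hk0 => hrej 0 hm₂ ?_
    rwa [← hτ, ← hk0, hk]
  have hk'pos : 0 < k' := by
    refine Nat.pos_of_ne_zero fun hk0 => hrej 0 hm₂ ?_
    rwa [← hk', hk0, hτ']
  have hloop := hu.glue hu' (hk.trans hτ'.symm)
  have hloop0 : glue k τ τ' 0 = c₂ 0 := by rw [glue_of_lt _ _ hkpos, hτ]
  have hloop1 : glue k τ τ' (k + k') = c₂ 0 := by rw [glue_add, hk']
  have hloopk : glue k τ τ' k ∈ A.accept := by
    have := glue_add k τ τ' 0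
    rw [add_zero] at this
    rwa [this, hτ']
  have hw₂ : ∃ w₂ : ℕ → α, A.IsWalk m₂ w₂ c₂ := by
    have : ∀ i, ∃ a, i < m₂ → c₂ (i + 1) ∈ A.step (c₂ i) a := fun i => by
      by_cases hi : i < m₂
      · exact (hE₂ i hi).imp fun a ha _ => ha
      · exact ⟨Classical.arbitrary α, fun h => absurd h hi⟩
    choose w₂ hw₂ using this
    exact ⟨w₂, hw₂⟩
  obtain ⟨w₂, hw₂⟩ := hw₂
  have hpos : 0 < k + k' := by omega
  have hr₁ := hloop.repeat hpos (hloop1.trans hloop0.symm) m₂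
  have hr₂ := hw₂.repeat hm₂ hc₂ (k + k')
  rw [mul_comm] at hr₂
  refine ⟨l, (k + k') * m₂, s, σ,
    fun j i => if j then glue k u u' (i % (k + k')) else w₂ (i % m₂),
    fun j i => if j then glue k τ τ' (i % (k + k')) else c₂ (i % m₂),
    hs, hσ, Nat.mul_pos hpos hm₂, ?_, ?_, ?_, ⟨k, ?_, ?_⟩, ?_⟩
  · rintro (_ | _)
    · exact hr₂
    · exact hr₁
  · rintro (_ | _)
    · simp [hl]
    · simp [hloop0, hl]
  · rintro (_ | _)
    · simp [hl]
    · simp [hloop0, hl]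
  · exact lt_of_lt_of_le (by omega : k < k + k') (Nat.le_mul_of_pos_right _ hm₂)
  · simpa [Nat.mod_eq_of_lt (by omega : k < k + k')] using hloopk
  · intro i _
    simpa using hrej _ (Nat.mod_lt i hm₂)

lemma IsDeterministic.isRun_unique (hA : A.IsDeterministic) {w : ℕ → α} {π π' : ℕ → Q}
    (h : A.IsRun w π) (h' : A.IsRun w π') : π = π' := by
  funext i
  induction i with
  | zero => rw [h.1, h'.1]
  | succ i ih =>
    obtain ⟨q, hq⟩ := hA (π i) (w i)
    have h1 := h.2 i
    have h2 := h'.2 i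
    rw [← ih] at h2
    rw [hq] at h1 h2
    exact h1.trans h2.symm

/-- After a prefix, a deterministic automaton reads a sequence of blocks of which only those marked
`true` visit an accepting state. It accepts if and only if such blocks occur infinitely often. -/
lemma IsDeterministic.glue_blocks_mem_language_iff (hA : A.IsDeterministic) {l m : ℕ}
    {s : ℕ → α} {σ : ℕ → Q} {w : Bool → ℕ → α} {π : Bool → ℕ → Q}
    (hs : A.IsWalk l s σ) (hσ : σ 0 = A.start) (hm : 0 < m)
    (hw : ∀ j, A.IsWalk m (w j) (π j)) (h0 : ∀ j, π j 0 = σ l) (h1 : ∀ j, π j m = σ l)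
    (hacc : ∃ i < m, π true i ∈ A.accept) (hrej : ∀ i < m, π false i ∉ A.accept)
    (b : ℕ → Bool) :
    glue l s (blocks m w b) ∈ A.language ↔ ∃ᶠ j in atTop, b j = true := by
  have hb0 : blocks m π b 0 = σ l := by
    have := blocks_mul_add π b 0 hm
    rwa [mul_zero, add_zero, h0] at this
  have hrun : A.IsRun (glue l s (blocks m w b)) (glue l σ (blocks m π b)) := by
    refine ⟨?_, fun i => ?_⟩
    · rcases Nat.eq_zero_or_pos l with rfl | hl
      · simpa [RVA.glue, hσ] using hb0
      · rw [glue_of_lt _ _ hl, hσ]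
    · exact hs.glue (IsWalk.blocks hm hw h0 h1 b (i + 1)) hb0.symm i (by omega)
  constructor
  · rintro ⟨ρ, hρ, q, hq, hqa⟩
    obtain rfl := hA.isRun_unique hρ hrun
    by_contra hfin
    rw [not_frequently, eventually_atTop] at hfin
    obtain ⟨N, hN⟩ := hfin
    refine hq (eventually_atTop.2 ⟨l + m * N, fun k hk hkq => ?_⟩)
    obtain ⟨k, rfl⟩ := Nat.exists_eq_add_of_le (show l ≤ k by omega)
    have hkN : N ≤ k / m := (Nat.le_div_iff_mul_le hm).2 (by rw [mul_comm]; omega)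
    rw [glue_add, RVA.blocks, Bool.eq_false_of_not_eq_true (hN _ hkN)] at hkq
    exact hrej _ (Nat.mod_lt k hm) (hkq ▸ hqa)
  · intro hinf
    obtain ⟨i, hi, hia⟩ := hacc
    refine ⟨_, hrun, π true i, ?_, hia⟩
    refine frequently_atTop.2 fun N => ?_
    obtain ⟨j, hj, hbj⟩ := frequently_atTop.1 hinf N
    refine ⟨l + (m * j + i), ?_, by rw [glue_add, blocks_mul_add _ _ _ hi, hbj]⟩
    have := Nat.le_mul_of_pos_left j hm
    omega

end BuchiAutomaton

/-! ### Encodings made of blocks -/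

lemma IsEncoding.exists_eq_none_iff {n r : ℕ} {w : ℕ → Letter n r} {x : Fin n → ℝ}
    (h : IsEncoding w x) : ∃ p, ∀ k, w k = none ↔ k = p := by
  obtain ⟨p, u, v, hu, hp, hv, -⟩ := h
  refine ⟨p, fun k => ⟨fun hk => ?_, fun hk => hk ▸ hp⟩⟩
  rcases lt_trichotomy k p with h | h | h
  · exact absurd ((hu ⟨k, h⟩).symm.trans hk) (by simp)
  · exact h
  · obtain ⟨j, rfl⟩ := Nat.exists_eq_add_of_lt h
    have := hv j
    rw [show p + 1 + j = p + j + 1 by omega, hk] at this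
    exact absurd this (by simp)

/-- If the words in which the block `true` occurs infinitely often are encodings, then so are all
the words made of the blocks, and the encoded vector depends continuously on the sequence of
blocks. -/
lemma exists_continuous_isEncoding {n r l m : ℕ} (hr : 0 < r) (hm : 0 < m)
    {s : ℕ → Letter n r} {w : Bool → ℕ → Letter n r}
    (h : ∀ b : ℕ → Bool, (∃ᶠ j in atTop, b j = true) →
      ∃ x, IsEncoding (glue l s (blocks m w b)) x) :
    ∃ f : (ℕ → Bool) → Fin n → ℝ, Continuous f ∧
      ∀ b, IsEncoding (glue l s (blocks m w b)) (f b) := by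
  have : NeZero r := ⟨hr.ne'⟩
  -- a block that contains the separator could be read twice, but the separator occurs only once
  have hblock : ∀ j, ∀ i < m, w j i ≠ none := by
    intro j i hi hnone
    have hfreq : ∃ᶠ k in atTop, (fun k => if k = 0 ∨ k = 1 then j else true) k = true :=
      Eventually.frequently <| by
        filter_upwards [eventually_ge_atTop 2] with k hk
        simp [show k ≠ 0 by omega, show k ≠ 1 by omega]
    obtain ⟨x, hx⟩ := h _ hfreq
    obtain ⟨p, hp⟩ := hx.exists_eq_none_iff
    have h0 := (hp (l + (m * 0 + i))).1 (by rw [glue_add, blocks_mul_add _ _ _ hi]; simpa)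
    have h1 := (hp (l + (m * 1 + i))).1 (by rw [glue_add, blocks_mul_add _ _ _ hi]; simpa)
    omega
  obtain ⟨x, p, u, v, hu, hp, -, hx⟩ := h (fun _ => true) (Eventually.frequently (by simp))
  have hpl : p < l := by
    by_contra hlp
    obtain ⟨k, rfl⟩ := Nat.exists_eq_add_of_le (not_lt.1 hlp)
    rw [glue_add] at hp
    exact hblock _ _ (Nat.mod_lt k hm) hp
  have hsv : ∀ k < l, k ≠ p → s k ≠ none := by
    intro k hk hkp hnone
    obtain ⟨x, hx⟩ := h (fun _ => true) (Eventually.frequently (by simp))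
    obtain ⟨p', hp'⟩ := hx.exists_eq_none_iff
    have h1 := (hp' k).1 (by rw [glue_of_lt _ _ hk, hnone])
    have h2 := (hp' p).1 hp
    omega
  choose z hz hxz using hx
  -- the letters after the separator; the default value `0` is never used
  let d : (ℕ → Bool) → ℕ → Fin n → Fin r := fun b k =>
    (glue l s (blocks m w b) (p + 1 + k)).getD 0
  refine ⟨fun b i => z i + Real.ofDigits fun k => d b k i, ?_, fun b => ?_⟩
  · refine continuous_pi fun i => continuous_const.add (Real.continuous_ofDigits.comp ?_)
    refine continuous_pi fun k => ?_
    rcases lt_or_ge (p + 1 + k) l with hk | hk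
    · simp only [d, glue_of_lt _ _ hk]
      exact continuous_const
    · obtain ⟨j, hj⟩ := Nat.exists_eq_add_of_le hk
      simp only [d, hj, glue_add, blocks]
      exact (continuous_of_discreteTopology
        (f := fun c : Bool => (w c (j % m)).getD 0 i)).comp (continuous_apply (j / m))
  · refine ⟨p, u, d b, fun j => ?_, ?_, fun k => ?_, fun i => ⟨z i, hz i, rfl⟩⟩
    · rw [← hu j, glue_of_lt _ _ (by omega), glue_of_lt _ _ (by omega)]
    · rwa [glue_of_lt _ _ hpl] at hp ⊢
    · have hne : glue l s (blocks m w b) (p + 1 + k) ≠ none := by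
        rcases lt_or_ge (p + 1 + k) l with hk | hk
        · rw [glue_of_lt _ _ hk]
          exact hsv _ hk (by omega)
        · obtain ⟨j, hj⟩ := Nat.exists_eq_add_of_le hk
          rw [hj, glue_add]
          exact hblock _ _ (Nat.mod_lt j hm)
      obtain ⟨a, ha⟩ := Option.ne_none_iff_exists'.1 hne
      simp [d, ha]

/-- Membership in the represented set can be tested on any one encoding. -/
lemma IsRVA.mem_representedSet_iff {n r : ℕ} {Q : Type*} {A : BuchiAutomaton (Letter n r) Q}
    (hA : IsRVA A) {w : ℕ → Letter n r} {x : Fin n → ℝ} (h : IsEncoding w x) :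
    x ∈ representedSet A ↔ w ∈ A.language := by
  refine ⟨fun ⟨w', hw', hx'⟩ => ?_, fun hw => ⟨w, hw, h⟩⟩
  rcases hA.2 x with hall | hnone
  · exact hall w h
  · exact absurd hw' (hnone w' hx')

end RVA

theorem mainTheorem4 (n r : ℕ) (hn : 0 < n) (hr : 1 < r) {Q : Type*} [Finite Q]
    (A : RVA.BuchiAutomaton (RVA.Letter n r) Q) (hdet : A.IsDeterministic)
    (hA : RVA.IsRVA A) (hdef : RVA.DefinableRZ (RVA.representedSet A)) :
    A.IsInherentlyWeak := by
  by_contra hweak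
  obtain ⟨l, m, s, σ, w, π, hs, hσ, hm, hw, h0, h1, hacc, hrej⟩ :=
    RVA.BuchiAutomaton.exists_walks_of_not_isInherentlyWeak hweak
  have hlang := hdet.glue_blocks_mem_language_iff hs hσ hm hw h0 h1 hacc hrej
  obtain ⟨f, hf, henc⟩ := RVA.exists_continuous_isEncoding (by omega) hm
    fun b hb => hA.1 _ ((hlang b).2 hb)
  refine RVA.not_isGδ_eventually_false ?_
  convert hdef.isGδ_compl.preimage hf using 1
  ext b
  exact ((hA.mem_representedSet_iff (henc b)).trans (hlang b)).not.symm
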